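/- Let $d\ge 1$ and let $\mathbb S^d\subset\mathbb R^{d+1}$ be the unit sphere with its standard surface measure. For $\mathbb K=\mathbb C$ or $\mathbb K=\mathbb R$ and $k\in\mathbb N=\{0,1,2,\dots\}$ let $E^k_{\mathbb K}\subset L^2(\mathbb S^d;\mathbb K)$ be the space of spherical harmonics of degree $k$ (restrictions to $\mathbb S^d$ of the harmonic homogeneous polynomials of degree $k$ on $\mathbb R^{d+1}$ with coefficients in $\mathbb K$), equipped with the $L^2$ inner product, and let $N_k=\dim_{\mathbb K} E^k_{\mathbb K}$. Fixing an arbitrary reference orthonormal basis $(e_{k,m})_{1\le m\le N_k}$ of each $E^k_{\mathbb K}$, identify the orthonormal bases of $E^k_{\mathbb K}$ with the elements $B_k$ of the unitary group $U(N_k)$ if $\mathbb K=\mathbb C$ (the orthogonal group $O(N_k)$ if $\mathbb K=\mathbb R$) through $b_{k,l}=\sum_m (B_k)_{l,m}e_{k,m}$. The Hilbert bases of $L^2(\mathbb S^d;\mathbb K)$ made of spherical harmonics are thus identified with $$\mathcal B=\prod_{k\in\mathbb N}U(N_k)\qquad\Big(\text{resp. } \tilde{\mathcal B}=\prod_{k\in\mathbb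 N}O(N_k)\Big),$$ equipped with the product probability measure $\nu=\bigotimes_k\nu_k$ (resp. $\tilde\nu=\bigotimes_k\tilde\nu_k$) of the normalized Haar measures $\nu_k$ on $U(N_k)$ (resp. $\tilde\nu_k$ on $O(N_k)$). Then there exist constants $C,c,c_0>0$, depending only on $d$, such that for all $r\ge 0$ $$\nu\Big(\Big\{B=(b_{k,l})_{k\in\mathbb N,\,1\le l\le N_k}\in\mathcal B:\ \exists k,l,\ \|b_{k,l}\|_{L^\infty(\mathbb S^d)}>c_0\log^{1/2}(k)+r\Big\}\Big)\le Ce^{-cr^2},$$ $$\tilde\nu\Big(\Big\{B=(b_{k,l})_{k\in\mathbb N,\,1\le l\le N_k}\in\tilde{\mathcal B}:\ \exists k,l,\ \|b_{k,l}\|_{L^\infty(\mathbb S^d)}>c_0\log^{1/2}(k)+r\Big\}\Big)\le Ce^{-cr^2},$$ with the convention $\log^{1/2}(0)=0$. -/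

import Mathlib

open MeasureTheory
open scoped ENNReal

noncomputable section

namespace SphHarm

/-- The unit sphere `S^d` of `ℝ^(d+1)`. -/
abbrev Sph (d : ℕ) : Type :=
  Metric.sphere (0 : EuclideanSpace ℝ (Fin (d + 1))) 1

/-- The (unnormalized) surface measure of `S^d`, i.e. its Riemannian volume. -/
def surface (d : ℕ) : Measure (Sph d) :=
  (volume : Measure (EuclideanSpace ℝ (Fin (d + 1)))).toSphere

instance (d : ℕ) : IsFiniteMeasure (surface d) := by
  unfold surface; infer_instance

/-- The Laplacian `∑ i, ∂²/∂X_i²` on polynomials. -/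
def polyLaplacian (𝕜 : Type) [RCLike 𝕜] (n : ℕ) :
    MvPolynomial (Fin n) 𝕜 →ₗ[𝕜] MvPolynomial (Fin n) 𝕜 :=
  ∑ i : Fin n, (MvPolynomial.pderiv i).toLinearMap ∘ₗ (MvPolynomial.pderiv i).toLinearMap

/-- Homogeneous polynomials of degree `k` in `n` variables that are harmonic. -/
def harmonicPolys (𝕜 : Type) [RCLike 𝕜] (n k : ℕ) : Submodule 𝕜 (MvPolynomial (Fin n) 𝕜) :=
  MvPolynomial.homogeneousSubmodule (Fin n) 𝕜 k ⊓ LinearMap.ker (polyLaplacian 𝕜 n)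

/-- The `i`-th coordinate, as a `𝕜`-valued continuous function on `S^d`. -/
def coordFun (𝕜 : Type) [RCLike 𝕜] (d : ℕ) (i : Fin (d + 1)) : C(Sph d, 𝕜) where
  toFun x := ((x.1 i : ℝ) : 𝕜)
  continuous_toFun := by fun_prop

/-- Restriction of a polynomial in `d + 1` variables to the sphere `S^d`. -/
def restrictSph (𝕜 : Type) [RCLike 𝕜] (d : ℕ) :
    MvPolynomial (Fin (d + 1)) 𝕜 →ₗ[𝕜] C(Sph d, 𝕜) :=
  (MvPolynomial.aeval (coordFun 𝕜 d)).toLinearMap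

/-- The space `E^k` of `𝕜`-valued spherical harmonics of degree `k` on `S^d`, as a subspace of
the Hilbert space `L²(S^d; 𝕜)`. -/
def sphHarmonics (𝕜 : Type) [RCLike 𝕜] (d k : ℕ) : Submodule 𝕜 (Lp 𝕜 2 (surface d)) :=
  ((harmonicPolys 𝕜 (d + 1) k).map (restrictSph 𝕜 d)).map
    (ContinuousMap.toLp (E := 𝕜) 2 (surface d) 𝕜).toLinearMap

instance (𝕜 : Type) [RCLike 𝕜] (d k : ℕ) : FiniteDimensional 𝕜 (sphHarmonics 𝕜 d k) := by
  have h1 : Module.Finite 𝕜 (MvPolynomial.homogeneousSubmodule (Fin (d + 1)) 𝕜 k) :=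
    Module.Finite.iff_fg.2 (MvPolynomial.homogeneousSubmodule_fg (R := 𝕜) (σ := Fin (d + 1)) k)
  have h2 : Module.Finite 𝕜 (harmonicPolys 𝕜 (d + 1) k) :=
    Submodule.finiteDimensional_of_le
      (inf_le_left : harmonicPolys 𝕜 (d + 1) k ≤
        MvPolynomial.homogeneousSubmodule (Fin (d + 1)) 𝕜 k)
  unfold sphHarmonics
  infer_instance

/-- `N_k = dim E^k`. -/
def dimE (𝕜 : Type) [RCLike 𝕜] (d k : ℕ) : ℕ := Module.finrank 𝕜 (sphHarmonics 𝕜 d k)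

/-- The unitary group `U(N)` for `𝕜 = ℂ`; for `𝕜 = ℝ` (trivial conjugation) this is the
orthogonal group `O(N)`. -/
abbrev UGrp (𝕜 : Type) [RCLike 𝕜] (N : ℕ) : Type := Matrix.unitaryGroup (Fin N) 𝕜

instance (𝕜 : Type) [RCLike 𝕜] (N : ℕ) : MeasurableSpace (UGrp 𝕜 N) := borel _

instance (𝕜 : Type) [RCLike 𝕜] (N : ℕ) : BorelSpace (UGrp 𝕜 N) := ⟨rfl⟩

instance (𝕜 : Type) [RCLike 𝕜] (N : ℕ) : CompactSpace (UGrp 𝕜 N) := by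
  refine isCompact_iff_compactSpace.1 ?_
  have hK : IsCompact (Set.pi Set.univ fun _ : Fin N => Set.pi Set.univ fun _ : Fin N =>
      Metric.closedBall (0 : 𝕜) 1) :=
    isCompact_univ_pi fun _ => isCompact_univ_pi fun _ => isCompact_closedBall _ _
  refine hK.of_isClosed_subset ?_ ?_
  · have : ((Matrix.unitaryGroup (Fin N) 𝕜 : Set (Matrix (Fin N) (Fin N) 𝕜))) =
        {A : Matrix (Fin N) (Fin N) 𝕜 | A * star A = 1} := by
      ext A; exact Matrix.mem_unitaryGroup_iff
    rw [this]
    exact isClosed_eq (by fun_prop) continuous_const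
  · intro A hA i _ j _
    simpa using entry_norm_bound_of_unitary hA i j

/-- The Haar probability measure of the compact group `U(N)` (resp. `O(N)`). -/
def haarProb (𝕜 : Type) [RCLike 𝕜] (N : ℕ) : Measure (UGrp 𝕜 N) :=
  Measure.haarMeasure (⊤ : TopologicalSpace.PositiveCompacts (UGrp 𝕜 N))

instance (𝕜 : Type) [RCLike 𝕜] (N : ℕ) : IsProbabilityMeasure (haarProb 𝕜 N) :=
  ⟨by simpa [haarProb] using
    Measure.haarMeasure_self (K₀ := (⊤ : TopologicalSpace.PositiveCompacts (UGrp 𝕜 N)))⟩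

/-- The space `∏_k U(N_k)` (resp. `∏_k O(N_k)`) of Hilbert bases of `L²(S^d; 𝕜)` made of
spherical harmonics. -/
abbrev BasisSpace (𝕜 : Type) [RCLike 𝕜] (d : ℕ) : Type := ∀ k : ℕ, UGrp 𝕜 (dimE 𝕜 d k)

/-- The product probability measure `⊗_k ν_k` of the Haar measures. -/
def basisMeasure (𝕜 : Type) [RCLike 𝕜] (d : ℕ) : Measure (BasisSpace 𝕜 d) :=
  Measure.infinitePi fun k => haarProb 𝕜 (dimE 𝕜 d k)

/-- The linear combinations of an orthonormal family whose coefficients are the rows of a unitary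
matrix form an orthonormal family. -/
theorem orthonormal_rotate {𝕜 E : Type} [RCLike 𝕜] [NormedAddCommGroup E] [InnerProductSpace 𝕜 E]
    {N : ℕ} (e : OrthonormalBasis (Fin N) 𝕜 E) (U : UGrp 𝕜 N) :
    Orthonormal 𝕜 fun l => ∑ m, (U : Matrix (Fin N) (Fin N) 𝕜) l m • e m := by
  rw [orthonormal_iff_ite]
  intro l l'
  have h := congrFun (congrFun (Matrix.mem_unitaryGroup_iff.1 U.2) l') l
  rw [e.orthonormal.inner_sum]
  simp only [Matrix.mul_apply, Matrix.star_apply, Matrix.one_apply] at h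
  simp only [eq_comm (a := l) (b := l')]
  rw [← h]
  refine Finset.sum_congr rfl fun m _ => ?_
  rw [mul_comm]; rfl

/-- The identification of the unitary (orthogonal) group with the set of orthonormal bases of `E`
given by a reference orthonormal basis `e`: the matrix `U` is sent to the orthonormal basis whose
`l`-th vector is `∑ m, U l m • e m`. -/
def rotate {𝕜 E : Type} [RCLike 𝕜] [NormedAddCommGroup E] [InnerProductSpace 𝕜 E]
    {N : ℕ} (e : OrthonormalBasis (Fin N) 𝕜 E) (U : UGrp 𝕜 N) :
    OrthonormalBasis (Fin N) 𝕜 E :=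
  OrthonormalBasis.mk (orthonormal_rotate e U) (by
    have hfd : FiniteDimensional 𝕜 E := e.toBasis.finiteDimensional_of_finite
    refine ((orthonormal_rotate e U).linearIndependent.span_eq_top_of_card_eq_finrank' ?_).ge
    rw [Module.finrank_eq_card_basis e.toBasis])

/-- The reference data: an orthonormal basis of each `E^k`. -/
abbrev RefBasis (𝕜 : Type) [RCLike 𝕜] (d : ℕ) : Type :=
  ∀ k : ℕ, OrthonormalBasis (Fin (dimE 𝕜 d k)) 𝕜 (sphHarmonics 𝕜 d k)

/-- The element `b_{k,l}` of the Hilbert basis represented by `B`. -/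
def basisElt {𝕜 : Type} [RCLike 𝕜] {d : ℕ} (e : RefBasis 𝕜 d) (B : BasisSpace 𝕜 d)
    (k : ℕ) (l : Fin (dimE 𝕜 d k)) : Lp 𝕜 2 (surface d) :=
  (rotate (e k) (B k) l : sphHarmonics 𝕜 d k)

/-- The event that some `b_{k,l}` has `L^∞` norm larger than `c₀ log^{1/2}(k) + r`.
Here `Real.log 0 = 0`, so that the threshold is `r` for `k = 0`, as for `k = 1`. -/
def largeEvent {𝕜 : Type} [RCLike 𝕜] {d : ℕ} (e : RefBasis 𝕜 d) (c₀ r : ℝ) :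
    Set (BasisSpace 𝕜 d) :=
  {B | ∃ (k : ℕ) (l : Fin (dimE 𝕜 d k)),
    ENNReal.ofReal (c₀ * Real.sqrt (Real.log k) + r) <
      eLpNorm (basisElt e B k l) ∞ (surface d)}

end SphHarm

end

/-! Each value `b_{k,l}(x)` is subgaussian at a scale independent of `k`, `l` and `x`. Right
invariance of Haar measure makes the moments of the pairing of a row with a vector `a` depend on
`‖a‖` only (`rowMoment_congr`). One may thus replace `a` by a multiple of a sign vector, average
over all signs, and apply Khintchine's inequality for each fixed matrix (`rowMoment_le`); this gains
a factor `N^{-q}`. For `a = (f_m(x))`, rotation invariance gives `‖a‖² = N/σ`, with `σ` the total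
surface measure (`kernel_eq`), so the dimension cancels.

To pass from points to the supremum without a net, note that `g^q` is the restriction of a
homogeneous polynomial of degree `kq`. The reproducing kernel of that space bounds `‖g‖_∞^{2q}` by
`∫ |g|^{2q}` at a cost polynomial in `kq` (`norm_pow_le_of_homogeneous`). Markov's inequality and
summation of the moments give the tail `8 (k+1)^{d+1} exp(-T²/(2A))` (`measureReal_rowComb_le`). A
union bound over `l` and `k` finishes: the term `c₀ log^{1/2} k` in the threshold supplies a
negative power of `k` that beats all polynomial factors (`exp_threshold_le`). -/

namespace SphHarm

/-! ### Moments of random sign sums. -/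

section Rademacher

/-- The sign `±1` attached to a Boolean. -/
def boolSign (b : Bool) : ℝ := cond b 1 (-1)

/-- Independence of the signs factors the exponential sum, and each factor is controlled by `cosh x
≤ exp (x²/2)`. -/
lemma sum_exp_signs_le {N : ℕ} (a : Fin N → ℝ) (t : ℝ) (ha : ∑ m, a m ^ 2 ≤ 1) :
    ∑ ε : Fin N → Bool, Real.exp (t * ∑ m, a m * boolSign (ε m)) ≤
      2 ^ N * Real.exp (t ^ 2 / 2) := by
  have h1 : ∀ ε : Fin N → Bool, Real.exp (t * ∑ m, a m * boolSign (ε m)) =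
      ∏ m, Real.exp (t * (a m * boolSign (ε m))) := fun ε => by
    rw [Finset.mul_sum, Real.exp_sum]
  have h2 : ∑ ε : Fin N → Bool, ∏ m, Real.exp (t * (a m * boolSign (ε m))) =
      ∏ m, ∑ b : Bool, Real.exp (t * (a m * boolSign b)) := by
    rw [Finset.prod_univ_sum, Fintype.piFinset_univ]
  have h3 : ∀ m, ∑ b : Bool, Real.exp (t * (a m * boolSign b)) ≤
      2 * Real.exp ((t * a m) ^ 2 / 2) := fun m => by
    have := Real.cosh_le_exp_half_sq (t * a m)
    rw [Real.cosh_eq] at this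
    simp only [Fintype.sum_bool, boolSign, cond_true, cond_false, mul_one, mul_neg]
    linarith
  simp_rw [h1]
  rw [h2]
  calc _ ≤ ∏ m : Fin N, 2 * Real.exp ((t * a m) ^ 2 / 2) :=
        Finset.prod_le_prod (fun m _ => Finset.sum_nonneg fun _ _ => (Real.exp_pos _).le)
          fun m _ => h3 m
    _ = 2 ^ N * Real.exp (t ^ 2 / 2 * ∑ m, a m ^ 2) := by
        rw [Finset.prod_mul_distrib, ← Real.exp_sum, Finset.mul_sum]
        simp only [Finset.prod_const, Finset.card_univ, Fintype.card_fin]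
        congr 2
        exact Finset.sum_congr rfl fun m _ => by ring
    _ ≤ _ := by
        gcongr
        nlinarith [sq_nonneg t]

/-- Only one factorial is kept: the factor `q^q` will cancel against `t^{2q}` in the moment bound.
-/
lemma factorial_two_mul_le (q : ℕ) :
    ((2 * q).factorial : ℝ) ≤ 4 ^ q * q.factorial * (q : ℝ) ^ q := by
  have h : (2 * q).factorial ≤ 4 ^ q * q.factorial * q ^ q := by
    have h1 := Nat.choose_mul_factorial_mul_factorial (show q ≤ 2 * q by omega)
    have h2 : 2 * q - q = q := by omega
    rw [h2, ← Nat.centralBinom_eq_two_mul_choose] at h1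
    rw [← h1]
    gcongr
    · exact Nat.centralBinom_le_four_pow q
    · exact Nat.factorial_le_pow q
  exact_mod_cast h

lemma sum_pow_signs_le {N : ℕ} (a : Fin N → ℝ) (q : ℕ) (ha : ∑ m, a m ^ 2 ≤ 1) :
    ∑ ε : Fin N → Bool, (∑ m, a m * boolSign (ε m)) ^ (2 * q) ≤
      2 ^ N * (2 * (2 * Real.exp 1) ^ q * q.factorial) := by
  -- This `t` minimises `t^{-2q} exp(t²/2)`, the factor obtained when exponential moments are
  -- converted into the moment of order `2q`.
  set t : ℝ := Real.sqrt (2 * q)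
  have ht : t ^ 2 = 2 * q := Real.sq_sqrt (by positivity)
  have hq : (0 : ℝ) < (q : ℝ) ^ q := by exact_mod_cast Nat.pow_self_pos
  have h1 : ∀ x : ℝ, (2 * q : ℝ) ^ q * x ^ (2 * q) ≤
      (2 * q).factorial * (Real.exp (t * x) + Real.exp (-t * x)) := fun x => by
    have h := Real.pow_div_factorial_le_exp (x := |t * x|) (abs_nonneg _) (2 * q)
    rw [div_le_iff₀ (by positivity)] at h
    have h' : (2 * q : ℝ) ^ q * x ^ (2 * q) = |t * x| ^ (2 * q) := by
      rw [pow_mul |t * x|, sq_abs, mul_pow t, ht, mul_pow (2 * q : ℝ), pow_mul x]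
    have h'' : Real.exp |t * x| ≤ Real.exp (t * x) + Real.exp (-t * x) := by
      rcases abs_cases (t * x) with h | h <;> rw [h.1]
      · linarith [Real.exp_pos (-t * x)]
      · rw [← neg_mul]; linarith [Real.exp_pos (t * x)]
    rw [h']
    exact h.trans (by rw [mul_comm]; gcongr)
  have h2 : (2 * q : ℝ) ^ q * ∑ ε : Fin N → Bool, (∑ m, a m * boolSign (ε m)) ^ (2 * q) ≤
      (2 * q).factorial * (2 ^ N * Real.exp q + 2 ^ N * Real.exp q) := by
    have e1 := sum_exp_signs_le a t ha
    have e2 := sum_exp_signs_le a (-t) ha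
    rw [neg_sq] at e2
    rw [ht, mul_div_cancel_left₀ _ two_ne_zero] at e1 e2
    rw [Finset.mul_sum]
    refine (Finset.sum_le_sum fun ε _ => h1 _).trans ?_
    rw [← Finset.mul_sum, Finset.sum_add_distrib]
    gcongr
  have h3 : (2 * q).factorial * (2 ^ N * Real.exp q + 2 ^ N * Real.exp q) ≤
      (2 * q : ℝ) ^ q * (2 ^ N * (2 * (2 * Real.exp 1) ^ q * q.factorial)) := by
    calc _ ≤ (4 ^ q * q.factorial * (q : ℝ) ^ q) *
          (2 ^ N * Real.exp q + 2 ^ N * Real.exp q) := by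
          gcongr; exact factorial_two_mul_le q
      _ = _ := by
          rw [← Real.exp_one_pow, mul_pow, mul_pow, show (4 : ℝ) = 2 * 2 by norm_num, mul_pow]
          ring
  refine le_of_mul_le_mul_left (h2.trans h3) ?_
  rw [mul_pow]; positivity

/-- Khintchine's inequality for even moments. -/
lemma sum_norm_pow_signs_le {𝕜 : Type} [RCLike 𝕜] {N : ℕ} (a : Fin N → 𝕜) (q : ℕ)
    (ha : ∑ m, ‖a m‖ ^ 2 ≤ 1) :
    ∑ ε : Fin N → Bool, ‖∑ m, a m * ((boolSign (ε m) : ℝ) : 𝕜)‖ ^ (2 * q) ≤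
      2 ^ N * (4 * (4 * Real.exp 1) ^ q * q.factorial) := by
  have hre := sum_pow_signs_le (fun m => RCLike.re (a m)) q <| le_trans
    (Finset.sum_le_sum fun m _ => by
      rw [← sq_abs]; gcongr; exact RCLike.abs_re_le_norm _) ha
  have him := sum_pow_signs_le (fun m => RCLike.im (a m)) q <| le_trans
    (Finset.sum_le_sum fun m _ => by
      rw [← sq_abs]; gcongr; exact RCLike.abs_im_le_norm _) ha
  have h : ∀ ε : Fin N → Bool, ‖∑ m, a m * ((boolSign (ε m) : ℝ) : 𝕜)‖ ^ (2 * q) ≤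
      2 ^ q * ((∑ m, RCLike.re (a m) * boolSign (ε m)) ^ (2 * q) +
        (∑ m, RCLike.im (a m) * boolSign (ε m)) ^ (2 * q)) := fun ε => by
    rw [pow_mul, ← RCLike.normSq_eq_def', RCLike.normSq_apply, map_sum, map_sum]
    simp only [RCLike.re_mul_ofReal, RCLike.im_mul_ofReal, ← sq]
    refine (add_pow_le (sq_nonneg _) (sq_nonneg _) q).trans ?_
    rw [← pow_mul, ← pow_mul]
    have : (2 : ℝ) ^ (q - 1) ≤ 2 ^ q := pow_le_pow_right₀ one_le_two (Nat.sub_le _ _)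
    refine mul_le_mul_of_nonneg_right this ?_
    rw [pow_mul, pow_mul]; positivity
  refine (Finset.sum_le_sum fun ε _ => h ε).trans ?_
  rw [← Finset.mul_sum, Finset.sum_add_distrib]
  calc _ ≤ 2 ^ q * (2 ^ N * (2 * (2 * Real.exp 1) ^ q * q.factorial) +
        2 ^ N * (2 * (2 * Real.exp 1) ^ q * q.factorial)) := by gcongr
    _ = _ := by
      rw [show (4 * Real.exp 1) = 2 * (2 * Real.exp 1) by ring, mul_pow 2 (2 * Real.exp 1)]; ring

end Rademacher

/-! ### Subgaussian rows of Haar matrices. -/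

section Haar

variable (𝕜 : Type) [RCLike 𝕜]

instance (N : ℕ) : (haarProb 𝕜 N).IsHaarMeasure := by
  unfold haarProb; infer_instance

/-- A right translate of left Haar measure is again a left Haar probability measure, so uniqueness
applies. -/
instance (N : ℕ) : (haarProb 𝕜 N).IsMulRightInvariant := by
  refine ⟨fun g => ?_⟩
  have : IsProbabilityMeasure ((haarProb 𝕜 N).map (· * g)) :=
    Measure.isProbabilityMeasure_map (by fun_prop)
  exact Measure.isHaarMeasure_eq_of_isProbabilityMeasure _ _

variable {𝕜}

/-- The unitary group acts transitively on vectors of a given norm. -/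
lemma exists_unitary_mulVec_eq {N : ℕ} (a b : EuclideanSpace 𝕜 (Fin N)) (h : ‖a‖ = ‖b‖) :
    ∃ V : UGrp 𝕜 N, ∀ l, ∑ m, (V : Matrix (Fin N) (Fin N) 𝕜) l m * a m = b l := by
  obtain ⟨T, hT⟩ : ∃ T : EuclideanSpace 𝕜 (Fin N) ≃ₗᵢ[𝕜] EuclideanSpace 𝕜 (Fin N), T a = b := by
    by_cases ha : a = 0
    · refine ⟨LinearIsometryEquiv.refl 𝕜 _, ?_⟩
      subst ha
      rw [norm_zero, eq_comm, norm_eq_zero] at h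
      rw [h]; rfl
    · let S : Submodule 𝕜 (EuclideanSpace 𝕜 (Fin N)) := Submodule.span 𝕜 {a}
      let f := LinearEquiv.toSpanNonzeroSingleton 𝕜 _ a ha
      let L : S →ₗᵢ[𝕜] EuclideanSpace 𝕜 (Fin N) :=
        { toLinearMap := (LinearMap.toSpanSingleton 𝕜 _ b) ∘ₗ f.symm.toLinearMap
          norm_map' := fun x => by
            obtain ⟨c, rfl⟩ := f.surjective x
            have : f c = c • a := by simp [f]
            change ‖f.symm (f c) • b‖ = ‖(f c : EuclideanSpace 𝕜 (Fin N))‖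
            rw [f.symm_apply_apply, this, norm_smul, norm_smul, h] }
      have hL : L ⟨a, Submodule.mem_span_singleton_self a⟩ = b := by
        have : (⟨a, Submodule.mem_span_singleton_self a⟩ : S) = f 1 := by
          ext1; simp [f]
        rw [this]
        change (f.symm (f 1)) • b = b
        simp
      -- The isometry sending `a` to `b` on the line of `a` extends to the whole space; finite
      -- dimension makes the extension bijective.
      refine ⟨L.extend.toLinearIsometryEquiv rfl, ?_⟩
      rw [← hL]
      exact L.extend_apply ⟨a, Submodule.mem_span_singleton_self a⟩
  let e := EuclideanSpace.basisFun (Fin N) 𝕜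
  refine ⟨⟨_, T.toMatrix_mem_unitaryGroup e e⟩, fun l => ?_⟩
  have := congrFun (LinearMap.toMatrix_mulVec_repr e.toBasis e.toBasis T.toLinearMap a) l
  simpa [Matrix.mulVec, dotProduct, e, hT] using this

/-- The moment of order `2 q` of the scalar product of a row of a Haar matrix with `a`. -/
noncomputable def rowMoment {N : ℕ} (q : ℕ) (l : Fin N) (a : Fin N → 𝕜) : ℝ :=
  ∫ U : UGrp 𝕜 N, ‖∑ m, (U : Matrix (Fin N) (Fin N) 𝕜) l m * a m‖ ^ (2 * q) ∂haarProb 𝕜 N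

lemma continuous_row_entry {N : ℕ} (l m : Fin N) :
    Continuous fun U : UGrp 𝕜 N => (U : Matrix (Fin N) (Fin N) 𝕜) l m :=
  continuous_subtype_val.matrix_elem l m

lemma integrable_of_continuous {N : ℕ} {f : UGrp 𝕜 N → ℝ} (hf : Continuous f) :
    Integrable f (haarProb 𝕜 N) :=
  hf.integrable_of_hasCompactSupport (HasCompactSupport.of_compactSpace f)

lemma integrable_row {N : ℕ} (q : ℕ) (l : Fin N) (a : Fin N → 𝕜) :
    Integrable (fun U : UGrp 𝕜 N =>
      ‖∑ m, (U : Matrix (Fin N) (Fin N) 𝕜) l m * a m‖ ^ (2 * q)) (haarProb 𝕜 N) :=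
  integrable_of_continuous <| ((continuous_finsetSum _ fun m _ =>
    (continuous_row_entry l m).mul continuous_const).norm).pow _

/-- Choose a unitary `V` with `V a = b`: a row of `U V` paired with `a` is the row of `U` paired
with `b`, and `U V` has the law of `U`. -/
lemma rowMoment_congr {N : ℕ} (q : ℕ) (l : Fin N) (a b : Fin N → 𝕜)
    (h : ∑ m, ‖a m‖ ^ 2 = ∑ m, ‖b m‖ ^ 2) : rowMoment q l a = rowMoment q l b := by
  obtain ⟨V, hV⟩ := exists_unitary_mulVec_eq (WithLp.toLp 2 a) (WithLp.toLp 2 b) (by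
    rw [EuclideanSpace.norm_eq, EuclideanSpace.norm_eq]; exact congrArg _ h)
  unfold rowMoment
  rw [← integral_mul_right_eq_self _ V]
  congr 1
  ext U
  congr 2
  simp only [Submonoid.coe_mul, Matrix.mul_apply, Finset.sum_mul]
  rw [Finset.sum_comm]
  refine Finset.sum_congr rfl fun j _ => ?_
  have hj : b j = ∑ m, (V : Matrix (Fin N) (Fin N) 𝕜) j m * a m := (hV j).symm
  rw [hj, Finset.mul_sum]
  exact Finset.sum_congr rfl fun m _ => mul_assoc _ _ _

lemma rowMoment_smul {N : ℕ} (q : ℕ) (l : Fin N) (a : Fin N → 𝕜) (s : 𝕜) :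
    rowMoment q l (fun m => s * a m) = ‖s‖ ^ (2 * q) * rowMoment q l a := by
  unfold rowMoment
  rw [← integral_const_mul]
  congr 1
  ext U
  rw [← mul_pow, ← norm_mul, Finset.mul_sum]
  congr 2
  exact Finset.sum_congr rfl fun m _ => by ring

lemma sum_norm_sq_row {N : ℕ} (U : UGrp 𝕜 N) (l : Fin N) :
    ∑ m, ‖(U : Matrix (Fin N) (Fin N) 𝕜) l m‖ ^ 2 = 1 := by
  have h := congrFun (congrFun (Matrix.mem_unitaryGroup_iff.1 U.2) l) l
  simp only [Matrix.mul_apply, Matrix.star_apply, Matrix.one_apply_eq, RCLike.star_def,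
    RCLike.mul_conj] at h
  exact_mod_cast h

lemma norm_boolSign (b : Bool) : ‖((boolSign b : ℝ) : 𝕜)‖ = 1 := by
  cases b <;> simp [boolSign]

/-- The rows of a Haar matrix have subgaussian moments. -/
theorem rowMoment_le {N : ℕ} (q : ℕ) (l : Fin N) (a : Fin N → 𝕜) :
    (N : ℝ) ^ q * rowMoment q l a ≤
      4 * (4 * Real.exp 1) ^ q * q.factorial * (∑ m, ‖a m‖ ^ 2) ^ q := by
  have hN : (0 : ℝ) < N := by exact_mod_cast l.pos
  set S : ℝ := ∑ m, ‖a m‖ ^ 2 with hS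
  have hS0 : 0 ≤ S := Finset.sum_nonneg fun _ _ => sq_nonneg _
  let sg : (Fin N → Bool) → Fin N → 𝕜 := fun ε m => ((boolSign (ε m) : ℝ) : 𝕜)
  -- Every sign vector has squared norm `N`, so `√(S/N)` times it has the norm of `a`.
  have h1 : ∀ ε, (N : ℝ) ^ q * rowMoment q l a = S ^ q * rowMoment q l (sg ε) := fun ε => by
    have h : rowMoment q l a =
        rowMoment q l (fun m => ((Real.sqrt (S / N) : ℝ) : 𝕜) * sg ε m) := by
      refine rowMoment_congr q l _ _ ?_
      simp_rw [norm_mul, sg, norm_boolSign, mul_one, RCLike.norm_ofReal, sq_abs]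
      rw [Real.sq_sqrt (by positivity), Finset.sum_const, Finset.card_univ, Fintype.card_fin,
        nsmul_eq_mul, mul_div_cancel₀ _ hN.ne']
    rw [h, rowMoment_smul, RCLike.norm_ofReal, pow_mul, sq_abs, Real.sq_sqrt (by positivity),
      div_pow]
    field_simp
  have h2 : ∑ ε, rowMoment q l (sg ε) ≤
      2 ^ N * (4 * (4 * Real.exp 1) ^ q * q.factorial) := by
    unfold rowMoment
    -- With the sum inside the integral, `U` is frozen and its unit row plays the part of the
    -- coefficients in Khintchine's inequality.
    rw [← integral_finsetSum _ fun ε _ => integrable_row q l _]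
    calc _ ≤ ∫ _ : UGrp 𝕜 N, (2 ^ N * (4 * (4 * Real.exp 1) ^ q * q.factorial) : ℝ)
          ∂haarProb 𝕜 N :=
          integral_mono (integrable_finsetSum _ fun ε _ => integrable_row q l _)
            (integrable_const _) fun U => sum_norm_pow_signs_le _ q (sum_norm_sq_row U l).le
      _ = _ := by simp
  have h3 : (2 : ℝ) ^ N * ((N : ℝ) ^ q * rowMoment q l a) =
      S ^ q * ∑ ε, rowMoment q l (sg ε) := by
    rw [Finset.mul_sum, ← Finset.sum_congr rfl fun ε _ => h1 ε]
    simp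
  refine le_of_mul_le_mul_left ?_ (pow_pos two_pos N : (0 : ℝ) < 2 ^ N)
  rw [h3]
  calc _ ≤ S ^ q * (2 ^ N * (4 * (4 * Real.exp 1) ^ q * q.factorial)) := by gcongr
    _ = _ := by ring

end Haar

/-! ### Rotation invariance and reproducing kernels on the sphere. -/

section Rotation

variable {d : ℕ}

/-- The Euclidean space containing `S^d`. -/
abbrev Amb (d : ℕ) : Type := EuclideanSpace ℝ (Fin (d + 1))

/-- The action of a linear isometry on the sphere. -/
noncomputable def sphRot (R : Amb d ≃ₗᵢ[ℝ] Amb d) : C(Sph d, Sph d) where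
  toFun x := ⟨R x.1, by simp⟩
  continuous_toFun := by fun_prop

lemma exists_sphRot_eq (x y : Sph d) : ∃ R : Amb d ≃ₗᵢ[ℝ] Amb d, sphRot R x = y :=
  -- The reflection in the hyperplane orthogonal to `x - y` exchanges the two points.
  ⟨_, Subtype.ext (Submodule.reflection_sub (v := x.1) (w := y.1) (by simp))⟩

-- Surface measure is the dimension times the volume of the cone over a set, so invariance reduces
-- to that of Lebesgue measure.
open scoped Pointwise in
lemma measurePreserving_sphRot (R : Amb d ≃ₗᵢ[ℝ] Amb d) :
    MeasurePreserving (sphRot R) (surface d) (surface d) := by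
  refine ⟨(sphRot R).continuous.measurable, ?_⟩
  ext s hs
  rw [Measure.map_apply (sphRot R).continuous.measurable hs]
  unfold surface
  rw [Measure.toSphere_apply' _ hs,
    Measure.toSphere_apply' _ ((sphRot R).continuous.measurable hs)]
  congr 1
  conv_rhs => rw [← R.measurePreserving.measure_preimage_equiv (f := R.toMeasurableEquiv)]
  congr 1
  ext x
  simp only [Set.mem_smul, Set.mem_image, Set.mem_preimage]
  constructor
  · rintro ⟨t, ht, _, ⟨y, hy, rfl⟩, rfl⟩
    exact ⟨t, ht, _, ⟨sphRot R y, hy, rfl⟩, (R.map_smul t _).symm⟩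
  · rintro ⟨t, ht, _, ⟨y, hy, rfl⟩, hx⟩
    refine ⟨t, ht, _, ⟨sphRot R.symm y, ?_, rfl⟩, ?_⟩
    · have : sphRot R (sphRot R.symm y) = y := Subtype.ext (R.apply_symm_apply _)
      rwa [this]
    · have h2 : t • (y : Amb d) = R x := hx
      apply R.injective
      rw [← h2, R.map_smul]
      exact congrArg (t • ·) (R.apply_symm_apply _)

lemma surface_real_univ_pos : 0 < (surface d).real Set.univ := by
  refine ENNReal.toReal_pos ?_ (measure_ne_top _ _)
  rw [Measure.measure_univ_ne_zero]
  exact Measure.toSphere_ne_zero _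

instance : (surface d).IsOpenPosMeasure := by unfold surface; infer_instance

variable {𝕜 : Type} [RCLike 𝕜]

/-- The linear map from continuous functions to `L²(S^d)`. -/
noncomputable abbrev toL2 (𝕜 : Type) [RCLike 𝕜] (d : ℕ) : C(Sph d, 𝕜) →ₗ[𝕜] Lp 𝕜 2 (surface d) :=
  (ContinuousMap.toLp (E := 𝕜) 2 (surface d) 𝕜).toLinearMap

lemma toL2_injective : Function.Injective (toL2 𝕜 d) :=
  ContinuousMap.toLp_injective (surface d)

lemma norm_toL2_sq (g : C(Sph d, 𝕜)) : ‖toL2 𝕜 d g‖ ^ 2 = ∫ x, ‖g x‖ ^ 2 ∂surface d := by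
  have h : inner 𝕜 (toL2 𝕜 d g) (toL2 𝕜 d g) = ((∫ x, ‖g x‖ ^ 2 ∂surface d : ℝ) : 𝕜) := by
    refine (ContinuousMap.inner_toLp (surface d) g g).trans ?_
    rw [← integral_ofReal]
    simp only [RCLike.mul_conj, RCLike.ofReal_pow]
  rw [inner_self_eq_norm_sq_to_K] at h
  exact_mod_cast h

/-- A space of functions on the sphere is rotation invariant. -/
def RotInvariant (V : Submodule 𝕜 C(Sph d, 𝕜)) : Prop :=
  ∀ g ∈ V, ∀ R : Amb d ≃ₗᵢ[ℝ] Amb d, g.comp (sphRot R) ∈ V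

section Reproducing

variable {V : Submodule 𝕜 C(Sph d, 𝕜)} {N : ℕ}
  {e : OrthonormalBasis (Fin N) 𝕜 (V.map (toL2 𝕜 d))} {f : Fin N → C(Sph d, 𝕜)}

/-- Expand `g` in the orthonormal family and apply Cauchy–Schwarz. Injectivity of the map to `L²`
makes the expansion hold at every point, not merely almost everywhere. -/
lemma norm_sq_eval_le_kernel (hf : ∀ i, toL2 𝕜 d (f i) = e i) {g : C(Sph d, 𝕜)} (hg : g ∈ V)
    (x : Sph d) :
    ‖g x‖ ^ 2 ≤ (∑ i, ‖f i x‖ ^ 2) * ∫ y, ‖g y‖ ^ 2 ∂surface d := by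
  let w : V.map (toL2 𝕜 d) := ⟨toL2 𝕜 d g, Submodule.mem_map_of_mem hg⟩
  have hg' : g = ∑ i, e.repr w i • f i := by
    apply toL2_injective
    have h := congrArg (Submodule.subtype _) (e.sum_repr w)
    rw [map_sum] at h ⊢
    simp only [map_smul, hf]
    exact h.symm
  have hw : ∫ y, ‖g y‖ ^ 2 ∂surface d = ∑ i, ‖e.repr w i‖ ^ 2 := by
    rw [← norm_toL2_sq, ← EuclideanSpace.norm_sq_eq, e.repr.norm_map]; rfl
  have hx : g x = ∑ i, e.repr w i * f i x := by
    conv_lhs => rw [hg']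
    simp [ContinuousMap.sum_apply]
  rw [hw, hx, mul_comm]
  calc _ ≤ (∑ i, ‖e.repr w i‖ * ‖f i x‖) ^ 2 := by
        gcongr
        exact (norm_sum_le _ _).trans_eq (Finset.sum_congr rfl fun i _ => norm_mul _ _)
    _ ≤ _ := Finset.sum_mul_sq_le_sq_mul_sq _ _ _

lemma integral_sphRot (R : Amb d ≃ₗᵢ[ℝ] Amb d) (h : Sph d → ℝ) (hh : Continuous h) :
    ∫ x, h (sphRot R x) ∂surface d = ∫ x, h x ∂surface d := by
  conv_rhs => rw [← (measurePreserving_sphRot R).map_eq]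
  rw [integral_map (sphRot R).continuous.aemeasurable hh.aestronglyMeasurable]

lemma kernel_sphRot_le (hV : RotInvariant V) (hfV : ∀ i, f i ∈ V)
    (hf : ∀ i, toL2 𝕜 d (f i) = e i) (R : Amb d ≃ₗᵢ[ℝ] Amb d) (x : Sph d) :
    ∑ i, ‖f i (sphRot R x)‖ ^ 2 ≤ ∑ i, ‖f i x‖ ^ 2 := by
  set K := ∑ i, ‖f i (sphRot R x)‖ ^ 2 with hK
  have hK0 : 0 ≤ K := Finset.sum_nonneg fun _ _ => sq_nonneg _
  -- This is the reproducing kernel at `R x`: both its value there and its squared `L²` norm are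
  -- `K`. Evaluating `g ∘ R` at `x` gives `K² ≤ (∑ ‖f i x‖²) K`.
  let g : C(Sph d, 𝕜) := ∑ i, star (f i (sphRot R x)) • f i
  have hgV : g ∈ V := V.sum_mem fun i _ => V.smul_mem _ (hfV i)
  have hgx : g (sphRot R x) = (K : 𝕜) := by
    simp [g, ContinuousMap.sum_apply, hK, RCLike.conj_mul]
  have hint : ∫ y, ‖g y‖ ^ 2 ∂surface d = K := by
    have h : toL2 𝕜 d g =
        ((∑ i, star (f i (sphRot R x)) • e i : V.map (toL2 𝕜 d)) : Lp 𝕜 2 (surface d)) := by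
      simp [g, map_sum, hf]
    have h' := e.sum_repr_symm (WithLp.toLp 2 fun i => star (f i (sphRot R x)))
    simp only at h'
    rw [← norm_toL2_sq, h, Submodule.norm_coe, h', e.repr.symm.norm_map,
      EuclideanSpace.norm_sq_eq]
    simp [hK]
  have h := norm_sq_eval_le_kernel hf (hV g hgV R) x
  have h2 : ∫ y, ‖(g.comp (sphRot R)) y‖ ^ 2 ∂surface d = K := by
    rw [← hint]
    exact integral_sphRot R (fun y => ‖g y‖ ^ 2) (by fun_prop)
  rw [h2, ContinuousMap.comp_apply, hgx, RCLike.norm_ofReal, sq_abs, sq] at h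
  rcases hK0.eq_or_lt with h0 | h0
  · rw [← h0]; exact Finset.sum_nonneg fun _ _ => sq_nonneg _
  · exact le_of_mul_le_mul_right h h0

/-- By transitivity of rotations the sum is constant on the sphere; its integral is `N`, since each
`f i` has unit norm. -/
lemma kernel_eq (hV : RotInvariant V) (hfV : ∀ i, f i ∈ V)
    (hf : ∀ i, toL2 𝕜 d (f i) = e i) (x : Sph d) :
    ∑ i, ‖f i x‖ ^ 2 = N / (surface d).real Set.univ := by
  have hconst : ∀ y, ∑ i, ‖f i y‖ ^ 2 = ∑ i, ‖f i x‖ ^ 2 := fun y => by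
    obtain ⟨R, hR⟩ := exists_sphRot_eq x y
    obtain ⟨R', hR'⟩ := exists_sphRot_eq y x
    apply le_antisymm
    · rw [← hR]; exact kernel_sphRot_le hV hfV hf R x
    · rw [← hR']; exact kernel_sphRot_le hV hfV hf R' y
  have h1 : ∫ y, ∑ i, ‖f i y‖ ^ 2 ∂surface d = N := by
    rw [integral_finsetSum _ fun i _ => Continuous.integrable_of_hasCompactSupport
      (by fun_prop) (HasCompactSupport.of_compactSpace _)]
    simp_rw [← norm_toL2_sq, hf, Submodule.norm_coe, e.orthonormal.1]
    simp
  simp_rw [hconst] at h1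
  rw [integral_const, smul_eq_mul] at h1
  rw [eq_div_iff surface_real_univ_pos.ne', mul_comm, h1]

/-- In a rotation invariant space the sup norm is controlled by the `L²` norm and the
dimension. -/
theorem norm_sq_le_of_rotInvariant [FiniteDimensional 𝕜 V] (hV : RotInvariant V)
    {g : C(Sph d, 𝕜)} (hg : g ∈ V) (x : Sph d) :
    ‖g x‖ ^ 2 ≤ Module.finrank 𝕜 V / (surface d).real Set.univ *
      ∫ y, ‖g y‖ ^ 2 ∂surface d := by
  let e := stdOrthonormalBasis 𝕜 (V.map (toL2 𝕜 d))
  have h : ∀ i, ∃ f ∈ V, toL2 𝕜 d f = e i := fun i => (e i).2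
  choose f hfV hf using h
  have h1 := norm_sq_eval_le_kernel hf hg x
  rw [kernel_eq hV hfV hf x] at h1
  refine h1.trans ?_
  gcongr
  exact Submodule.finrank_map_le _ _

end Reproducing

end Rotation

/-! ### Orthogonal changes of variables and powers of homogeneous polynomials. -/

section Polynomials

open MvPolynomial

variable {𝕜 : Type} [RCLike 𝕜]

/-- The linear forms given by the rows of a real matrix. -/
noncomputable def rowForm (𝕜 : Type) [RCLike 𝕜] {n : ℕ} (A : Matrix (Fin n) (Fin n) ℝ)
    (i : Fin n) : MvPolynomial (Fin n) 𝕜 :=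
  ∑ j, C ((A i j : ℝ) : 𝕜) * X j

lemma pderiv_rowForm {n : ℕ} (A : Matrix (Fin n) (Fin n) ℝ) (i j : Fin n) :
    pderiv j (rowForm 𝕜 A i) = C ((A i j : ℝ) : 𝕜) := by
  simp [rowForm, map_sum, pderiv_X, Pi.single_apply]

/-- The chain rule for a linear substitution; applied twice, it reduces invariance of the Laplacian
to orthonormality of the rows of `A`. -/
lemma pderiv_aeval_rowForm {n : ℕ} (A : Matrix (Fin n) (Fin n) ℝ) (j : Fin n)
    (p : MvPolynomial (Fin n) 𝕜) :
    pderiv j (aeval (rowForm 𝕜 A) p) =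
      ∑ i, C ((A i j : ℝ) : 𝕜) * aeval (rowForm 𝕜 A) (pderiv i p) := by
  induction p using MvPolynomial.induction_on with
  | C a => simp [algebraMap_eq]
  | add p q hp hq => simp only [map_add, hp, hq, mul_add, Finset.sum_add_distrib]
  | mul_X p k hp =>
    rw [map_mul, pderiv_mul, hp, aeval_X, pderiv_rowForm]
    simp only [pderiv_mul, map_add, map_mul, aeval_X, mul_add, Finset.sum_add_distrib,
      Finset.sum_mul, pderiv_X, Pi.single_apply]
    congr 1
    · exact Finset.sum_congr rfl fun i _ => by ring
    · simp [mul_comm]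

lemma polyLaplacian_apply {n : ℕ} (p : MvPolynomial (Fin n) 𝕜) :
    polyLaplacian 𝕜 n p = ∑ i, pderiv i (pderiv i p) := by
  simp [polyLaplacian, LinearMap.sum_apply]

/-- The Laplacian commutes with orthogonal changes of variables. -/
lemma polyLaplacian_aeval_rowForm {n : ℕ} (A : Matrix (Fin n) (Fin n) ℝ)
    (hA : A ∈ Matrix.unitaryGroup (Fin n) ℝ) (p : MvPolynomial (Fin n) 𝕜) :
    polyLaplacian 𝕜 n (aeval (rowForm 𝕜 A) p) = aeval (rowForm 𝕜 A) (polyLaplacian 𝕜 n p) := by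
  have hA' : ∀ i k, ∑ j, ((A i j : ℝ) : 𝕜) * ((A k j : ℝ) : 𝕜) = if i = k then 1 else 0 := by
    intro i k
    have h := congrFun (congrFun (Matrix.mem_unitaryGroup_iff.1 hA) i) k
    simp only [Matrix.mul_apply, Matrix.star_apply, star_trivial, Matrix.one_apply] at h
    have h2 := congrArg (fun t : ℝ => (t : 𝕜)) h
    push_cast at h2
    rw [h2]
    split_ifs <;> simp
  simp only [polyLaplacian_apply, pderiv_aeval_rowForm, map_sum, pderiv_C_mul, Finset.mul_sum]
  rw [Finset.sum_comm]
  refine Finset.sum_congr rfl fun i _ => ?_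
  rw [Finset.sum_comm]
  calc _ = ∑ k, C (∑ j, ((A i j : ℝ) : 𝕜) * ((A k j : ℝ) : 𝕜)) *
        aeval (rowForm 𝕜 A) (pderiv k (pderiv i p)) := by
        refine Finset.sum_congr rfl fun k _ => ?_
        rw [map_sum, Finset.sum_mul]
        exact Finset.sum_congr rfl fun j _ => by rw [C_mul, mul_assoc]
    _ = _ := by simp [hA']

variable {d : ℕ}

/-- The matrix of a linear isometry in the canonical basis. -/
noncomputable def isometryMatrix (R : Amb d ≃ₗᵢ[ℝ] Amb d) :
    Matrix (Fin (d + 1)) (Fin (d + 1)) ℝ :=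
  LinearMap.toMatrix (EuclideanSpace.basisFun (Fin (d + 1)) ℝ).toBasis
    (EuclideanSpace.basisFun (Fin (d + 1)) ℝ).toBasis R.toLinearMap

lemma isometryMatrix_mem (R : Amb d ≃ₗᵢ[ℝ] Amb d) :
    isometryMatrix R ∈ Matrix.unitaryGroup (Fin (d + 1)) ℝ :=
  R.toMatrix_mem_unitaryGroup _ _

lemma sum_isometryMatrix_mul (R : Amb d ≃ₗᵢ[ℝ] Amb d) (x : Amb d) (i : Fin (d + 1)) :
    ∑ j, isometryMatrix R i j * x j = R x i := by
  have := congrFun (LinearMap.toMatrix_mulVec_repr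
    (EuclideanSpace.basisFun (Fin (d + 1)) ℝ).toBasis
    (EuclideanSpace.basisFun (Fin (d + 1)) ℝ).toBasis R.toLinearMap x) i
  simpa [Matrix.mulVec, dotProduct, isometryMatrix] using this

lemma restrictSph_comp_sphRot (R : Amb d ≃ₗᵢ[ℝ] Amb d) (p : MvPolynomial (Fin (d + 1)) 𝕜) :
    (restrictSph 𝕜 d p).comp (sphRot R) =
      restrictSph 𝕜 d (aeval (rowForm 𝕜 (isometryMatrix R)) p) := by
  have h : (ContinuousMap.compRightAlgHom 𝕜 𝕜 (sphRot R)).comp (aeval (coordFun 𝕜 d)) =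
      (aeval (coordFun 𝕜 d)).comp (aeval (rowForm 𝕜 (isometryMatrix R))) := by
    refine MvPolynomial.algHom_ext fun i => ?_
    ext x
    have hx := congrArg (fun t : ℝ => (t : 𝕜)) (sum_isometryMatrix_mul R x.1 i)
    push_cast at hx
    simp only [AlgHom.comp_apply, aeval_X, rowForm, map_sum, map_mul, aeval_C]
    rw [ContinuousMap.sum_apply]
    exact hx.symm
  exact DFunLike.congr_fun h p

lemma isHomogeneous_aeval_rowForm {n k : ℕ} (A : Matrix (Fin n) (Fin n) ℝ)
    {p : MvPolynomial (Fin n) 𝕜} (hp : p.IsHomogeneous k) :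
    (aeval (rowForm 𝕜 A) p).IsHomogeneous k := by
  have := hp.aeval (rowForm 𝕜 A) (n := 1) fun i =>
    IsHomogeneous.sum _ _ _ fun j _ => by
      simpa using (isHomogeneous_C (Fin n) ((A i j : ℝ) : 𝕜)).mul (isHomogeneous_X 𝕜 j)
  simpa using this

lemma rotInvariant_homogeneous (k : ℕ) :
    RotInvariant ((homogeneousSubmodule (Fin (d + 1)) 𝕜 k).map (restrictSph 𝕜 d)) := by
  rintro _ ⟨p, hp, rfl⟩ R
  rw [restrictSph_comp_sphRot]
  exact Submodule.mem_map_of_mem (isHomogeneous_aeval_rowForm _ hp)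

lemma rotInvariant_harmonic (k : ℕ) :
    RotInvariant ((harmonicPolys 𝕜 (d + 1) k).map (restrictSph 𝕜 d)) := by
  rintro _ ⟨p, ⟨hp, hp'⟩, rfl⟩ R
  rw [restrictSph_comp_sphRot]
  refine Submodule.mem_map_of_mem ⟨isHomogeneous_aeval_rowForm _ hp, ?_⟩
  rw [SetLike.mem_coe, LinearMap.mem_ker] at hp' ⊢
  rw [polyLaplacian_aeval_rowForm _ (isometryMatrix_mem R), hp', map_zero]

instance (n k : ℕ) : FiniteDimensional 𝕜 (homogeneousSubmodule (Fin n) 𝕜 k) :=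
  Module.Finite.iff_fg.2 (homogeneousSubmodule_fg (Fin n) 𝕜 k)

/-- The monomials with all exponents at most `k` span. The count is crude, but any bound polynomial
in `k` suffices. -/
lemma finrank_homogeneousSubmodule_le (n k : ℕ) :
    Module.finrank 𝕜 (homogeneousSubmodule (Fin n) 𝕜 k) ≤ (k + 1) ^ n := by
  let φ : (Fin n → Fin (k + 1)) → MvPolynomial (Fin n) 𝕜 := fun s =>
    monomial (Finsupp.equivFunOnFinite.symm fun i => (s i : ℕ)) 1
  have h : homogeneousSubmodule (Fin n) 𝕜 k ≤ Submodule.span 𝕜 (Set.range φ) := by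
    intro p hp
    rw [p.as_sum]
    refine Submodule.sum_mem _ fun s hs => ?_
    have hdeg : s.degree = k := by
      rw [Finsupp.degree_eq_weight_one]
      exact hp (mem_support_iff.1 hs)
    have hs' : ∀ i, s i < k + 1 := fun i =>
      Nat.lt_succ_of_le (hdeg ▸ Finsupp.le_degree i s)
    have : monomial s (coeff s p) = coeff s p • φ fun i => ⟨s i, hs' i⟩ := by
      rw [smul_monomial, smul_eq_mul, mul_one]
      exact congrArg (fun t => monomial t (coeff s p)) (Finsupp.ext fun i => rfl)
    rw [this]
    exact Submodule.smul_mem _ _ (Submodule.subset_span ⟨_, rfl⟩)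
  have : FiniteDimensional 𝕜 (Submodule.span 𝕜 (Set.range φ)) :=
    FiniteDimensional.span_of_finite 𝕜 (Set.finite_range φ)
  calc _ ≤ Module.finrank 𝕜 (Submodule.span 𝕜 (Set.range φ)) := Submodule.finrank_mono h
    _ ≤ Fintype.card (Fin n → Fin (k + 1)) := finrank_range_le_card φ
    _ = _ := by simp

lemma dimE_le (k : ℕ) : dimE 𝕜 d k ≤ (k + 1) ^ (d + 1) := by
  have : FiniteDimensional 𝕜 (harmonicPolys 𝕜 (d + 1) k) :=
    Submodule.finiteDimensional_of_le (inf_le_left : _ ≤ homogeneousSubmodule (Fin (d + 1)) 𝕜 k)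
  calc _ ≤ Module.finrank 𝕜 ((harmonicPolys 𝕜 (d + 1) k).map (restrictSph 𝕜 d)) :=
        Submodule.finrank_map_le _ _
    _ ≤ Module.finrank 𝕜 (harmonicPolys 𝕜 (d + 1) k) := Submodule.finrank_map_le _ _
    _ ≤ Module.finrank 𝕜 (homogeneousSubmodule (Fin (d + 1)) 𝕜 k) :=
        Submodule.finrank_mono inf_le_left
    _ ≤ _ := finrank_homogeneousSubmodule_le _ _

/-- Control of the sup norm of a homogeneous polynomial on the sphere by its even moments. -/
theorem norm_pow_le_of_homogeneous {k : ℕ} {g : C(Sph d, 𝕜)}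
    (hg : g ∈ (homogeneousSubmodule (Fin (d + 1)) 𝕜 k).map (restrictSph 𝕜 d)) (q : ℕ)
    (x : Sph d) :
    ‖g x‖ ^ (2 * q) ≤ (k * q + 1 : ℝ) ^ (d + 1) / (surface d).real Set.univ *
      ∫ y, ‖g y‖ ^ (2 * q) ∂surface d := by
  obtain ⟨p, hp, rfl⟩ := hg
  -- The `L²` bound is applied to `g^q`, in degree `k * q`; harmonicity is lost under powers, hence
  -- the full homogeneous space.
  have hmem : restrictSph 𝕜 d p ^ q ∈
      (homogeneousSubmodule (Fin (d + 1)) 𝕜 (k * q)).map (restrictSph 𝕜 d) :=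
    ⟨p ^ q, IsHomogeneous.pow hp q, map_pow (aeval (coordFun 𝕜 d)) p q⟩
  have h := norm_sq_le_of_rotInvariant (rotInvariant_homogeneous (k * q)) hmem x
  simp only [ContinuousMap.pow_apply, norm_pow, ← pow_mul, mul_comm q 2] at h
  refine h.trans ?_
  have h0 : 0 ≤ ∫ y, ‖restrictSph 𝕜 d p y‖ ^ (2 * q) ∂surface d :=
    integral_nonneg fun y => by positivity
  gcongr
  exact_mod_cast (Submodule.finrank_map_le _ _).trans
    (finrank_homogeneousSubmodule_le (𝕜 := 𝕜) (d + 1) (k * q))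

end Polynomials

/-! ### Tail of the sup norm of one basis element. -/

section Tail

variable {𝕜 : Type} [RCLike 𝕜] {d : ℕ}

/-- A bound on all even moments in terms of factorials yields an exponential tail. -/
lemma le_exp_of_moments {p T A M : ℝ} (hA : 0 < A)
    (h : ∀ q : ℕ, p * T ^ (2 * q) ≤ M * A ^ q * q.factorial) :
    p ≤ 2 * M * Real.exp (-(1 / (2 * A)) * T ^ 2) := by
  -- The moments are summed with weights `(2A)^{-q}/q!`: the left side becomes an exponential, and
  -- the 2 turns the right side into a geometric series of ratio `1/2`.
  have h1 : HasSum (fun q : ℕ => (T ^ 2 / (2 * A)) ^ q / q.factorial)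
      (Real.exp (T ^ 2 / (2 * A))) := by
    rw [Real.exp_eq_exp_ℝ]
    exact NormedSpace.expSeries_div_hasSum_exp _
  have h2 : HasSum (fun q : ℕ => M * (1 / 2 : ℝ) ^ q) (M * 2) := hasSum_geometric_two.mul_left M
  have h3 := hasSum_le (fun q => by
    rw [div_pow, ← pow_mul, ← mul_div_assoc, ← mul_div_assoc, div_le_iff₀ (by positivity),
      div_le_iff₀ (by positivity), div_pow, one_pow, mul_pow 2 A]
    refine (h q).trans_eq ?_
    field_simp) (h1.mul_left p) h2
  rw [neg_mul, Real.exp_neg, ← div_eq_mul_inv, le_div_iff₀ (Real.exp_pos _), one_div_mul_eq_div]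
  linarith

/-- The scale of the subgaussian tails. -/
noncomputable def tailScale (d : ℕ) : ℝ :=
  2 ^ (d + 1) * (4 * Real.exp 1) / (surface d).real Set.univ

lemma tailScale_pos : 0 < tailScale d := by
  have := surface_real_univ_pos (d := d)
  unfold tailScale; positivity

/-- A linear combination of functions with coefficients from a row of a matrix. -/
noncomputable def rowComb {N : ℕ} (f : Fin N → C(Sph d, 𝕜)) (l : Fin N) (U : UGrp 𝕜 N) :
    C(Sph d, 𝕜) :=
  ∑ m, (U : Matrix (Fin N) (Fin N) 𝕜) l m • f m

lemma rowComb_apply {N : ℕ} (f : Fin N → C(Sph d, 𝕜)) (l : Fin N) (U : UGrp 𝕜 N) (x : Sph d) :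
    rowComb f l U x = ∑ m, (U : Matrix (Fin N) (Fin N) 𝕜) l m * f m x := by
  simp [rowComb, ContinuousMap.sum_apply]

lemma continuous_rowComb_pow {N : ℕ} (f : Fin N → C(Sph d, 𝕜)) (l : Fin N) (q : ℕ) :
    Continuous (Function.uncurry fun (U : UGrp 𝕜 N) (x : Sph d) =>
      ‖rowComb f l U x‖ ^ (2 * q)) := by
  simp only [rowComb_apply, Function.uncurry_def]
  exact ((continuous_finsetSum _ fun m _ => ((continuous_row_entry l m).comp continuous_fst).mul
    ((f m).continuous.comp continuous_snd)).norm).pow _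

/-- Required for the continuity of parametric integrals over the group. -/
instance (N : ℕ) : FirstCountableTopology (UGrp 𝕜 N) :=
  inferInstanceAs (FirstCountableTopology
    {A : Fin N → Fin N → 𝕜 // Matrix.of A ∈ Matrix.unitaryGroup (Fin N) 𝕜})

lemma continuous_integral_rowComb {N : ℕ} (f : Fin N → C(Sph d, 𝕜)) (l : Fin N) (q : ℕ) :
    Continuous fun U : UGrp 𝕜 N => ∫ x, ‖rowComb f l U x‖ ^ (2 * q) ∂surface d := by
  have := continuous_parametric_integral_of_continuous (μ := surface d)
    (continuous_rowComb_pow f l q) (isCompact_univ (X := Sph d))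
  simpa only [Measure.restrict_univ] using this

/-- By Fubini the row moments are taken at each fixed `x`, where `hf` cancels the factor `N^q`; the
bound no longer depends on `N`. -/
lemma integral_integral_rowComb_le {N : ℕ} (f : Fin N → C(Sph d, 𝕜)) (l : Fin N) (q : ℕ)
    (hf : ∀ x, ∑ m, ‖f m x‖ ^ 2 = N / (surface d).real Set.univ) :
    ∫ U : UGrp 𝕜 N, ∫ x, ‖rowComb f l U x‖ ^ (2 * q) ∂surface d ∂haarProb 𝕜 N ≤
      (surface d).real Set.univ *
        (4 * (4 * Real.exp 1 / (surface d).real Set.univ) ^ q * q.factorial) := by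
  have hσ := surface_real_univ_pos (d := d)
  have hN : (0 : ℝ) < N := by exact_mod_cast l.pos
  have hc := continuous_rowComb_pow f l q
  rw [integral_integral_swap_of_hasCompactSupport hc (HasCompactSupport.of_compactSpace _)]
  have hrow : ∀ x, ∫ U : UGrp 𝕜 N, ‖rowComb f l U x‖ ^ (2 * q) ∂haarProb 𝕜 N ≤
      4 * (4 * Real.exp 1 / (surface d).real Set.univ) ^ q * q.factorial := fun x => by
    have h := rowMoment_le q l fun m => f m x
    rw [hf x] at h
    simp only [rowComb_apply]
    refine le_of_mul_le_mul_left (h.trans_eq ?_) (pow_pos hN q)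
    rw [div_pow, div_pow]; ring
  have h := integral_mono_of_nonneg (μ := surface d)
    (Filter.Eventually.of_forall fun x => integral_nonneg fun U => by positivity)
    (integrable_const _) (Filter.Eventually.of_forall hrow)
  simpa using h

/-- The tail of the sup norm of a random element of the space of spherical harmonics. -/
lemma measureReal_rowComb_le {k N : ℕ} (f : Fin N → C(Sph d, 𝕜)) (l : Fin N)
    (hfV : ∀ m, f m ∈ (MvPolynomial.homogeneousSubmodule (Fin (d + 1)) 𝕜 k).map (restrictSph 𝕜 d))
    (hf : ∀ x, ∑ m, ‖f m x‖ ^ 2 = N / (surface d).real Set.univ) {T : ℝ} (hT : 0 ≤ T) :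
    (haarProb 𝕜 N).real {U | ∃ x, T ≤ ‖rowComb f l U x‖} ≤
      8 * (k + 1) ^ (d + 1) * Real.exp (-(1 / (2 * tailScale d)) * T ^ 2) := by
  have hσ := surface_real_univ_pos (d := d)
  rw [show (8 : ℝ) * (k + 1) ^ (d + 1) = 2 * (4 * (k + 1) ^ (d + 1)) by ring]
  refine le_exp_of_moments tailScale_pos fun q => ?_
  set σ := (surface d).real Set.univ
  set p := (haarProb 𝕜 N).real {U | ∃ x, T ≤ ‖rowComb f l U x‖}
  have hD : (0 : ℝ) < (k * q + 1) ^ (d + 1) := by positivity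
  have hmarkov := mul_meas_ge_le_integral_of_nonneg (μ := haarProb 𝕜 N)
    (Filter.Eventually.of_forall fun U : UGrp 𝕜 N =>
      integral_nonneg fun x => by positivity)
    (integrable_of_continuous (continuous_integral_rowComb f l q))
    (T ^ (2 * q) * σ / (k * q + 1) ^ (d + 1))
  have hsub : {U : UGrp 𝕜 N | ∃ x, T ≤ ‖rowComb f l U x‖} ⊆
      {U | T ^ (2 * q) * σ / (k * q + 1) ^ (d + 1) ≤
        ∫ x, ‖rowComb f l U x‖ ^ (2 * q) ∂surface d} := by
    rintro U ⟨x, hx⟩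
    have hmem : rowComb f l U ∈
        (MvPolynomial.homogeneousSubmodule (Fin (d + 1)) 𝕜 k).map (restrictSph 𝕜 d) :=
      Submodule.sum_mem _ fun m _ => Submodule.smul_mem _ _ (hfV m)
    have h := (pow_le_pow_left₀ hT hx (2 * q)).trans (norm_pow_le_of_homogeneous hmem q x)
    rw [div_mul_eq_mul_div, le_div_iff₀ hσ] at h
    rw [Set.mem_ofPred_eq, div_le_iff₀ hD, mul_comm (∫ x, _ ∂_)]
    exact h
  have hp : T ^ (2 * q) * σ / (k * q + 1) ^ (d + 1) * p ≤
      σ * (4 * (4 * Real.exp 1 / σ) ^ q * q.factorial) :=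
    (mul_le_mul_of_nonneg_left (measureReal_mono hsub) (by positivity)).trans
      (hmarkov.trans (integral_integral_rowComb_le f l q hf))
  -- The dependence on `q` must be geometric to be absorbed in the scale; this is the origin of the
  -- factor `2 ^ (d + 1)` in `tailScale`.
  have hkq : ((k * q + 1 : ℝ)) ^ (d + 1) ≤ (k + 1) ^ (d + 1) * (2 ^ (d + 1)) ^ q := by
    rw [← pow_mul, mul_comm (d + 1) q, pow_mul, ← mul_pow]
    have h2 : (q + 1 : ℝ) ≤ 2 ^ q := by exact_mod_cast Nat.lt_two_pow_self
    gcongr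
    calc (k * q + 1 : ℝ) ≤ (k + 1) * (q + 1) := by
          nlinarith [(Nat.cast_nonneg k : (0 : ℝ) ≤ k), (Nat.cast_nonneg q : (0 : ℝ) ≤ q)]
      _ ≤ _ := by gcongr
  have hp' : p * T ^ (2 * q) ≤
      (k * q + 1) ^ (d + 1) * (4 * (4 * Real.exp 1 / σ) ^ q * q.factorial) := by
    refine le_of_mul_le_mul_left ?_ hσ
    rw [div_mul_eq_mul_div, div_le_iff₀ hD] at hp
    linarith
  refine hp'.trans ((mul_le_mul_of_nonneg_right hkq (by positivity)).trans_eq ?_)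
  rw [tailScale, mul_div_assoc (2 ^ (d + 1) : ℝ), mul_pow (2 ^ (d + 1) : ℝ)]
  ring

lemma eLpNorm_toL2_top_le (g : C(Sph d, 𝕜)) {T : ℝ} (h : ∀ x, ‖g x‖ ≤ T) :
    eLpNorm (toL2 𝕜 d g) ∞ (surface d) ≤ ENNReal.ofReal T := by
  have h1 : (toL2 𝕜 d g : Sph d → 𝕜) =ᵐ[surface d] g := ContinuousMap.coeFn_toLp _ g
  rw [eLpNorm_congr_ae h1, eLpNorm_exponent_top]
  exact eLpNormEssSup_le_of_ae_bound (Filter.Eventually.of_forall h)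

/-- The tail of the `L^∞` norm of one element of a random orthonormal basis. -/
theorem measureReal_rotate_le {k : ℕ}
    (e : OrthonormalBasis (Fin (dimE 𝕜 d k)) 𝕜 (sphHarmonics 𝕜 d k)) (l : Fin (dimE 𝕜 d k))
    {T : ℝ} (hT : 0 ≤ T) :
    (haarProb 𝕜 (dimE 𝕜 d k)).real {U | ENNReal.ofReal T <
      eLpNorm ((rotate e U l : sphHarmonics 𝕜 d k) : Lp 𝕜 2 (surface d)) ∞ (surface d)} ≤
      8 * (k + 1) ^ (d + 1) * Real.exp (-(1 / (2 * tailScale d)) * T ^ 2) := by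
  have h : ∀ i, ∃ f ∈ (harmonicPolys 𝕜 (d + 1) k).map (restrictSph 𝕜 d), toL2 𝕜 d f = e i :=
    fun i => (e i).2
  choose f hfV hf using h
  have hle : (harmonicPolys 𝕜 (d + 1) k).map (restrictSph 𝕜 d) ≤
      (MvPolynomial.homogeneousSubmodule (Fin (d + 1)) 𝕜 k).map (restrictSph 𝕜 d) :=
    Submodule.map_mono inf_le_left
  refine le_trans (measureReal_mono ?_) (measureReal_rowComb_le f l (fun m => hle (hfV m))
    (kernel_eq (e := e) (rotInvariant_harmonic k) hfV hf) hT)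
  intro U hU
  by_contra hcon
  simp only [Set.mem_ofPred_eq, not_exists, not_le] at hcon hU
  refine hU.not_ge ?_
  have hb : ((rotate e U l : sphHarmonics 𝕜 d k) : Lp 𝕜 2 (surface d)) =
      toL2 𝕜 d (rowComb f l U) := by
    simp [rotate, rowComb, hf]
  rw [hb]
  exact eLpNorm_toL2_top_le _ fun x => (hcon x).le

end Tail

/-! ### Union bound over degrees and basis elements. -/

section UnionBound

variable {𝕜 : Type} [RCLike 𝕜] {d : ℕ}

/-- The coefficient of `log^{1/2} k` in the threshold. -/
noncomputable def logCoeff (d : ℕ) : ℝ := Real.sqrt (2 * tailScale d * (2 * (d + 1) + 2))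

lemma logCoeff_pos : 0 < logCoeff d :=
  Real.sqrt_pos.2 (mul_pos (mul_pos two_pos tailScale_pos) (by positivity))

/-- Dropping the nonnegative cross term of the square separates `r` from `k`. In the exponent
`2(d+1)+2` of `logCoeff`, one `d+1` pays for the number of basis elements, the other for the
prefactor of the tail, and the last 2 leaves a summable `1/(k+1)²`. -/
lemma exp_threshold_le (k : ℕ) {r : ℝ} (hr : 0 ≤ r) :
    (k + 1 : ℝ) ^ (2 * (d + 1)) *
      Real.exp (-(1 / (2 * tailScale d)) * (logCoeff d * Real.sqrt (Real.log k) + r) ^ 2) ≤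
      2 ^ (2 * (d + 1) + 2) * (1 / (k + 1 : ℝ) ^ 2) *
        Real.exp (-(1 / (2 * tailScale d)) * r ^ 2) := by
  have hA := tailScale_pos (d := d)
  have hlog : 0 ≤ Real.log k := Real.log_natCast_nonneg k
  have h1 : -(1 / (2 * tailScale d)) * (logCoeff d * Real.sqrt (Real.log k) + r) ^ 2 ≤
      -((2 * (d + 1) + 2 : ℕ) * Real.log k) + -(1 / (2 * tailScale d)) * r ^ 2 := by
    have h2 : (logCoeff d * Real.sqrt (Real.log k)) ^ 2 =
        2 * tailScale d * ((2 * (d + 1) + 2 : ℕ) * Real.log k) := by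
      rw [mul_pow, Real.sq_sqrt hlog, logCoeff, Real.sq_sqrt (by positivity)]
      push_cast; ring
    have h3 : 2 * tailScale d * ((2 * (d + 1) + 2 : ℕ) * Real.log k) + r ^ 2 ≤
        (logCoeff d * Real.sqrt (Real.log k) + r) ^ 2 := by
      rw [← h2, add_sq]
      have : 0 ≤ 2 * (logCoeff d * Real.sqrt (Real.log k)) * r := by
        have := (logCoeff_pos (d := d)).le
        positivity
      linarith
    have h4 := mul_le_mul_of_nonneg_left h3 (show 0 ≤ 1 / (2 * tailScale d) by positivity)
    have h5 : 1 / (2 * tailScale d) * (2 * tailScale d * ((2 * (d + 1) + 2 : ℕ) * Real.log k)) =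
        (2 * (d + 1) + 2 : ℕ) * Real.log k := by field_simp
    rw [mul_add, h5] at h4
    linarith
  have h6 : Real.exp (-((2 * (d + 1) + 2 : ℕ) * Real.log k)) ≤
      2 ^ (2 * (d + 1) + 2) / (k + 1 : ℝ) ^ (2 * (d + 1) + 2) := by
    rw [le_div_iff₀ (by positivity), Real.exp_neg, Real.exp_nat_mul]
    -- For `k = 0` the logarithm vanishes and the claim is `1 ≤ 2^n`; otherwise `k + 1 ≤ 2k`
    -- accounts for the power of 2.
    rcases Nat.eq_zero_or_pos k with rfl | hk
    · simpa using one_le_pow₀ one_le_two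
    · have hk' : (1 : ℝ) ≤ k := by exact_mod_cast hk
      rw [Real.exp_log (by linarith), inv_mul_le_iff₀ (by positivity), ← mul_pow]
      gcongr
      linarith
  calc _ ≤ (k + 1 : ℝ) ^ (2 * (d + 1)) *
        (2 ^ (2 * (d + 1) + 2) / (k + 1 : ℝ) ^ (2 * (d + 1) + 2) *
          Real.exp (-(1 / (2 * tailScale d)) * r ^ 2)) := by
        gcongr
        refine (Real.exp_le_exp.2 h1).trans ?_
        rw [Real.exp_add]
        gcongr
    _ = _ := by
        rw [pow_add (k + 1 : ℝ)]; field_simp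

lemma summable_one_div_succ_sq : Summable fun k : ℕ => 1 / (k + 1 : ℝ) ^ 2 := by
  have := (summable_nat_add_iff 1).2 (Real.summable_one_div_nat_pow.2 one_lt_two)
  simpa using this

/-- The multiplicative constant in the deviation inequality. -/
noncomputable def tailConst (d : ℕ) : ℝ :=
  8 * 2 ^ (2 * (d + 1) + 2) * ∑' k : ℕ, 1 / (k + 1 : ℝ) ^ 2

lemma tailConst_pos : 0 < tailConst d :=
  mul_pos (by positivity) (summable_one_div_succ_sq.tsum_pos (fun _ => by positivity) 0 (by simp))

/-- The deviation inequality for random Hilbert bases of spherical harmonics. -/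
theorem basisMeasure_largeEvent_le (e : RefBasis 𝕜 d) {r : ℝ} (hr : 0 ≤ r) :
    basisMeasure 𝕜 d (largeEvent e (logCoeff d) r) ≤
      ENNReal.ofReal (tailConst d * Real.exp (-(1 / (2 * tailScale d)) * r ^ 2)) := by
  set c := 1 / (2 * tailScale d)
  let T : ℕ → ℝ := fun k => logCoeff d * Real.sqrt (Real.log k) + r
  have hT : ∀ k, 0 ≤ T k := fun k =>
    add_nonneg (mul_nonneg logCoeff_pos.le (Real.sqrt_nonneg _)) hr
  let S : ∀ k, Fin (dimE 𝕜 d k) → Set (UGrp 𝕜 (dimE 𝕜 d k)) := fun k l =>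
    {U | ENNReal.ofReal (T k) <
      eLpNorm ((rotate (e k) U l : sphHarmonics 𝕜 d k) : Lp 𝕜 2 (surface d)) ∞ (surface d)}
  have hsub : largeEvent e (logCoeff d) r ⊆ ⋃ k, ⋃ l, (fun B => B k) ⁻¹' S k l := by
    rintro B ⟨k, l, h⟩
    exact Set.mem_iUnion₂.2 ⟨k, l, h⟩
  have hS : ∀ k l, basisMeasure 𝕜 d ((fun B => B k) ⁻¹' S k l) ≤
      ENNReal.ofReal (8 * (k + 1) ^ (d + 1) * Real.exp (-c * T k ^ 2)) := fun k l => by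
    have hmp := measurePreserving_eval_infinitePi (fun k => haarProb 𝕜 (dimE 𝕜 d k)) k
    -- This inequality holds for arbitrary sets, so measurability of `S k l` need not be checked.
    calc _ ≤ (basisMeasure 𝕜 d).map (fun B => B k) (S k l) :=
          Measure.le_map_apply hmp.measurable.aemeasurable _
      _ = haarProb 𝕜 (dimE 𝕜 d k) (S k l) := by rw [← hmp.map_eq]; rfl
      _ = ENNReal.ofReal ((haarProb 𝕜 (dimE 𝕜 d k)).real (S k l)) := by simp
      _ ≤ _ := ENNReal.ofReal_le_ofReal (measureReal_rotate_le (e k) l (hT k))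
  have hk : ∀ k, basisMeasure 𝕜 d (⋃ l, (fun B => B k) ⁻¹' S k l) ≤
      ENNReal.ofReal (8 * 2 ^ (2 * (d + 1) + 2) * Real.exp (-c * r ^ 2) *
        (1 / (k + 1 : ℝ) ^ 2)) := fun k => by
    calc _ ≤ ∑ l, basisMeasure 𝕜 d ((fun B => B k) ⁻¹' S k l) := measure_iUnion_fintype_le _ _
      _ ≤ ∑ _l : Fin (dimE 𝕜 d k),
          ENNReal.ofReal (8 * (k + 1) ^ (d + 1) * Real.exp (-c * T k ^ 2)) :=
          Finset.sum_le_sum fun l _ => hS k l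
      _ = ENNReal.ofReal (dimE 𝕜 d k * (8 * (k + 1) ^ (d + 1) * Real.exp (-c * T k ^ 2))) := by
          rw [ENNReal.ofReal_mul (Nat.cast_nonneg _), ENNReal.ofReal_natCast, Finset.sum_const,
            Finset.card_univ, Fintype.card_fin, nsmul_eq_mul]
      _ ≤ _ := by
          refine ENNReal.ofReal_le_ofReal ?_
          have hdim : (dimE 𝕜 d k : ℝ) ≤ (k + 1) ^ (d + 1) := by
            exact_mod_cast dimE_le (𝕜 := 𝕜) (d := d) k
          calc _ ≤ (k + 1 : ℝ) ^ (d + 1) *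
                (8 * (k + 1) ^ (d + 1) * Real.exp (-c * T k ^ 2)) := by gcongr
            _ = 8 * ((k + 1 : ℝ) ^ (2 * (d + 1)) * Real.exp (-c * T k ^ 2)) := by ring
            _ ≤ 8 * _ := mul_le_mul_of_nonneg_left (exp_threshold_le k hr) (by norm_num)
            _ = _ := by ring
  calc _ ≤ ∑' k, basisMeasure 𝕜 d (⋃ l, (fun B => B k) ⁻¹' S k l) :=
        (measure_mono hsub).trans (measure_iUnion_le _)
    _ ≤ ∑' k : ℕ, ENNReal.ofReal (8 * 2 ^ (2 * (d + 1) + 2) * Real.exp (-c * r ^ 2) *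
        (1 / (k + 1 : ℝ) ^ 2)) := ENNReal.tsum_le_tsum hk
    _ = ENNReal.ofReal (∑' k : ℕ, 8 * 2 ^ (2 * (d + 1) + 2) * Real.exp (-c * r ^ 2) *
        (1 / (k + 1 : ℝ) ^ 2)) :=
        (ENNReal.ofReal_tsum_of_nonneg (fun _ => by positivity)
          (summable_one_div_succ_sq.mul_left _)).symm
    _ = _ := by rw [tsum_mul_left, tailConst]; congr 1; ring

end UnionBound

end SphHarm

theorem mainTheorem11 (d : ℕ) (hd : 1 ≤ d) :
    ∃ C c c₀ : ℝ, 0 < C ∧ 0 < c ∧ 0 < c₀ ∧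
      ∀ r : ℝ, 0 ≤ r →
        (∀ e : SphHarm.RefBasis ℂ d,
          SphHarm.basisMeasure ℂ d (SphHarm.largeEvent e c₀ r) ≤
            ENNReal.ofReal (C * Real.exp (-c * r ^ 2))) ∧
        (∀ e : SphHarm.RefBasis ℝ d,
          SphHarm.basisMeasure ℝ d (SphHarm.largeEvent e c₀ r) ≤
            ENNReal.ofReal (C * Real.exp (-c * r ^ 2))) := by
  refine ⟨SphHarm.tailConst d, 1 / (2 * SphHarm.tailScale d), SphHarm.logCoeff d,
    SphHarm.tailConst_pos, ?_, SphHarm.logCoeff_pos, fun r hr => ⟨fun e => ?_, fun e => ?_⟩⟩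
  · exact one_div_pos.2 (mul_pos two_pos SphHarm.tailScale_pos)
  · exact SphHarm.basisMeasure_largeEvent_le e hr
  · exact SphHarm.basisMeasure_largeEvent_le e hr
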